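/- Let $(\Omega,\mathcal F,\mathbb P)$ be a probability space, let $1<p\le 2$ and $\frac1p+\frac1q=1$, and let $\mathcal C\subset\mathcal F$ be a sub-$\sigma$-algebra. Let $\rho:L^p_{\mathcal F}(\mathbb P)\to\mathbb R$ be a normalized convex operator, that is: $\rho(0)=0$; $\rho(\xi_1)\ge\rho(\xi_2)$ whenever $\xi_1\ge\xi_2$ a.s.; $\rho(\xi+c)=\rho(\xi)+c$ for $c\in\mathbb R$; and $\rho(\lambda\xi_1+(1-\lambda)\xi_2)\le\lambda\rho(\xi_1)+(1-\lambda)\rho(\xi_2)$ for $\lambda\in[0,1]$. For a probability measure $P\ll\mathbb P$ write $f^P=\frac{dP}{d\mathbb P}$ and $\alpha(P)=\sup\{E_P[\zeta]:\zeta\in L^p_{\mathcal F}(\mathbb P),\ \rho(\zeta)\le 0\}$, and let $$\mathcal P=\{P\ll\mathbb P \text{ a probability measure}:\ f^P\in L^q_{\mathcal F}(\mathbb P),\ \alpha(P)<\infty\}$$ be the representation set of $\rho$. Assume that $\rho$ is stable (for every $P\in\mathcal P$ and every sub-$\sigma$-algebra $\mathcal G\subset\mathcal F$, the function $f^P/\mathbb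 E[f^P|\mathcal G]$ is the density $f^Q$ of some $Q\in\mathcal P$) and proper (every $P\in\mathcal P$ is equivalent to $\mathbb P$). Let $L^{2p}_{\mathcal C}(\mathbb P)$ be the set of $\mathcal C$-measurable random variables in $L^{2p}(\mathbb P)$ and, for $M\ge 0$, let $L^{2p,M}_{\mathcal C}(\mathbb P)$ be the set of its elements with $L^{2p}(\mathbb P)$-norm at most $M$. Let $\xi\in L^{4p}_{\mathcal F}(\mathbb P)$. 1. For every $M\ge 0$ there is a $\hat P\in\mathcal P$ such that $$\inf_{\eta\in L^{2p,M}_{\mathcal C}(\mathbb P)}\big[E_{\hat P}[(\xi-\eta)^2]-\alpha(\hat P)\big]=\sup_{P\in\mathcal P}\ \inf_{\eta\in L^{2p,M}_{\mathcal C}(\mathbb P)}\big[E_{P}[(\xi-\eta)^2]-\alpha(P)\big].$$ 2. There is a $\hat P\in\mathcal P$ such that $$\inf_{\eta\in L^{2p}_{\mathcal C}(\mathbb P)}\big[E_{\hat P}[(\xi-\eta)^2]-\alpha(\hat P)\big]=\sup_{P\in\mathcal P}\ \inf_{\eta\in L^{2p}_{\mathcal C}(\mathbb P)}\big[E_{P}[(\xi-\eta)^2]-\alpha(P)\big].$$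 3. If $M\ge 0$ is such that for every $P\in\mathcal P$ the infimum of $E_P[(\xi-\eta)^2]-\alpha(P)$ over $\eta\in L^{2p}_{\mathcal C}(\mathbb P)$ equals its infimum over $\eta\in L^{2p,M}_{\mathcal C}(\mathbb P)$, then one and the same $\hat P\in\mathcal P$ can be chosen in 1 (for this $M$) and in 2. -/

import Mathlib

open MeasureTheory
open scoped ENNReal

noncomputable section

namespace MMSE

variable {Ω : Type*} {mΩ : MeasurableSpace Ω}

/-- A convex operator `ρ : L^p(ℙ) → ℝ`; the order on `Lp ℝ p ℙ` is the `ℙ`-almost sure one. -/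
structure IsConvexOperator (ℙ : Measure Ω) [IsProbabilityMeasure ℙ] (p : ℝ≥0∞)
    (ρ : Lp ℝ p ℙ → ℝ) : Prop where
  monotone : ∀ ξ₁ ξ₂ : Lp ℝ p ℙ, ξ₂ ≤ ξ₁ → ρ ξ₂ ≤ ρ ξ₁
  const_invariance : ∀ (ξ : Lp ℝ p ℙ) (c : ℝ), ρ (ξ + Lp.const p ℙ c) = ρ ξ + c
  convex : ∀ (ξ₁ ξ₂ : Lp ℝ p ℙ) (t : ℝ), 0 ≤ t → t ≤ 1 →
    ρ (t • ξ₁ + (1 - t) • ξ₂) ≤ t * ρ ξ₁ + (1 - t) * ρ ξ₂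

/-- `ρ` is normalized: `ρ(0) = 0`. -/
def IsNormalized {ℙ : Measure Ω} {p : ℝ≥0∞} (ρ : Lp ℝ p ℙ → ℝ) : Prop :=
  ρ 0 = 0

/-- The Radon-Nikodym derivative `f^P = dP/dℙ`, real valued. -/
def density (ℙ P : Measure Ω) (ω : Ω) : ℝ :=
  (P.rnDeriv ℙ ω).toReal

/-- The acceptance set `A_ρ = {ζ ∈ L^p(ℙ) : ρ(ζ) ≤ 0}`. -/
def acceptanceSet {ℙ : Measure Ω} {p : ℝ≥0∞} (ρ : Lp ℝ p ℙ → ℝ) : Set (Lp ℝ p ℙ) :=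
  {ζ | ρ ζ ≤ 0}

/-- The penalty `α(P) = sup_{ζ ∈ A_ρ} E_P[ζ]`, with values in the extended reals. It is used only
for `P ≪ ℙ` with `dP/dℙ ∈ L^q(ℙ)`, for which every `ζ ∈ L^p(ℙ)` is `P`-integrable. -/
def penalty {ℙ : Measure Ω} {p : ℝ≥0∞} (ρ : Lp ℝ p ℙ → ℝ) (P : Measure Ω) : EReal :=
  ⨆ ζ ∈ acceptanceSet ρ, ((∫ ω, ζ ω ∂P : ℝ) : EReal)

/-- The representation set: the probability measures `P ≪ ℙ` with `dP/dℙ ∈ L^q(ℙ)`,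
`1/p + 1/q = 1`, and `α(P) < ∞`. -/
def representationSet {ℙ : Measure Ω} {p : ℝ≥0∞} (ρ : Lp ℝ p ℙ → ℝ) : Set (Measure Ω) :=
  {P | IsProbabilityMeasure P ∧ P ≪ ℙ ∧ MemLp (density ℙ P) p.conjExponent ℙ ∧ penalty ρ P < ⊤}

/-- `ρ` is stable: for every `P` in the representation set and every sub-σ-algebra `C`, the
quotient `f^P / 𝔼[f^P | C]` is the density of some member of the representation set. -/
def IsStable {ℙ : Measure Ω} {p : ℝ≥0∞} (ρ : Lp ℝ p ℙ → ℝ) : Prop :=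
  ∀ P ∈ representationSet ρ, ∀ C : MeasurableSpace Ω, C ≤ mΩ →
    ∃ Q ∈ representationSet ρ,
      density ℙ Q =ᵐ[ℙ] fun ω => density ℙ P ω / (ℙ[density ℙ P | C]) ω

/-- `ρ` is proper: every member of the representation set is equivalent to `ℙ`. -/
def IsProper {ℙ : Measure Ω} {p : ℝ≥0∞} (ρ : Lp ℝ p ℙ → ℝ) : Prop :=
  ∀ P ∈ representationSet ρ, P ≪ ℙ ∧ ℙ ≪ P

/-- `L^r_C(ℙ)`: the `C`-measurable random variables in `L^r(ℙ)`. -/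
def LC (ℙ : Measure Ω) (C : MeasurableSpace Ω) (r : ℝ≥0∞) : Set (Ω → ℝ) :=
  {η | Measurable[C] η ∧ MemLp η r ℙ}

/-- `L^{r,M}_C(ℙ)`: the elements of `L^r_C(ℙ)` with norm at most `M`. -/
def LCBall (ℙ : Measure Ω) (C : MeasurableSpace Ω) (r : ℝ≥0∞) (M : ℝ) : Set (Ω → ℝ) :=
  {η | η ∈ LC ℙ C r ∧ eLpNorm η r ℙ ≤ ENNReal.ofReal M}

/-- The objective `E_P[(ξ - η)²] - α(P)`. -/
def objective {ℙ : Measure Ω} {p : ℝ≥0∞} (ρ : Lp ℝ p ℙ → ℝ) (ξ : Ω → ℝ) (P : Measure Ω)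
    (η : Ω → ℝ) : EReal :=
  ((∫ ω, (ξ ω - η ω) ^ 2 ∂P : ℝ) : EReal) - penalty ρ P

/-- The value `inf_{η ∈ S} [E_P[(ξ - η)²] - α(P)]` of the prior `P`, over a set `S` of estimators. -/
def infValue {ℙ : Measure Ω} {p : ℝ≥0∞} (ρ : Lp ℝ p ℙ → ℝ) (ξ : Ω → ℝ) (S : Set (Ω → ℝ))
    (P : Measure Ω) : EReal :=
  ⨅ η ∈ S, objective ρ ξ P η

/-- The value `sup_{P ∈ 𝒫} inf_{η ∈ S} [E_P[(ξ - η)²] - α(P)]`, with `𝒫` the representation set. -/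
def supInfValue {ℙ : Measure Ω} {p : ℝ≥0∞} (ρ : Lp ℝ p ℙ → ℝ) (ξ : Ω → ℝ) (S : Set (Ω → ℝ)) :
    EReal :=
  ⨆ P ∈ representationSet ρ, infValue ρ ξ S P

end MMSE

end

namespace MMSE

variable {Ω : Type*} {mΩ : MeasurableSpace Ω} {ℙ : Measure Ω} {p : ℝ≥0∞}

/-! This is a compactness argument; no minimax theorem enters. Writing the penalty as a supremum
turns the value of a prior into an infimum of `φ Y - φ ζ` over losses `Y` and acceptable `ζ`, where
`φ` is the expectation functional (`infValue_eq_dualValue`). Each term is weak-* continuous in `φ`,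
so the value is upper semicontinuous.

Superlevel sets are relatively compact: if the value is at least `c`, testing with one loss `X` and
`ζ = X + Z - ρ(X + Z)` gives `φ Z ≤ ρ(X + Z) - c` for all `Z`. Banach–Steinhaus makes this pointwise
bound uniform, and Banach–Alaoglu applies. So a maximizer exists among positive normalized
functionals (`exists_isMax_dualValue`).

The maximizer is the expectation under a measure with density in `L^q` (`exists_measure_of_dual`),
and its penalty is finite because its value is not `⊥`. Hahn–Banach supplies one prior to start from
(`representationSet_nonempty`). -/

/-! ### Automatic continuity of positive functionals -/

lemma smul_Lp_nonneg {c : ℝ} (hc : 0 ≤ c) {Z : Lp ℝ p ℙ} (hZ : 0 ≤ Z) : 0 ≤ c • Z := by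
  rw [← Lp.coeFn_nonneg] at hZ ⊢
  filter_upwards [hZ, Lp.coeFn_smul c Z] with ω h1 h2
  rw [h2]
  exact mul_nonneg hc h1

/-- A positive linear functional on `L^p` is bounded on the positive cone. -/
lemma exists_bound_of_nonneg [Fact (1 ≤ p)] (g : Lp ℝ p ℙ →ₗ[ℝ] ℝ) (hg : ∀ Z, 0 ≤ Z → 0 ≤ g Z) :
    ∃ K : ℝ, ∀ Z, 0 ≤ Z → g Z ≤ K * ‖Z‖ := by
  by_contra! hcon
  choose x hx0 hx using fun n : ℕ => hcon (4 ^ n)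
  have hxn (n : ℕ) : 0 < ‖x n‖ := by
    rw [norm_pos_iff]
    rintro h
    simpa [h] using hx n
  -- Rescale to norm `2⁻ⁿ`, so that the series converges while `g (y n) ≥ 2ⁿ`; by positivity `g` of
  -- the sum dominates every term.
  set c : ℕ → ℝ := fun n => (2 ^ n * ‖x n‖)⁻¹ with hc
  have hcpos (n : ℕ) : 0 < c n := by have := hxn n; positivity
  set y : ℕ → Lp ℝ p ℙ := fun n => c n • x n with hy
  have hynn (n : ℕ) : 0 ≤ y n := smul_Lp_nonneg (hcpos n).le (hx0 n)
  have hynorm (n : ℕ) : ‖y n‖ = (1 / 2) ^ n := by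
    have := (hxn n).ne'
    have h : ‖y n‖ = c n * ‖x n‖ := by
      rw [hy, norm_smul, Real.norm_of_nonneg (hcpos n).le]
    rw [h, hc, one_div, inv_pow]
    field_simp
  have hsum : Summable y := Summable.of_norm (by simpa only [hynorm] using summable_geometric_two)
  have hle (n : ℕ) : (2 : ℝ) ^ n ≤ g (∑' k, y k) := by
    have h1 : y n ≤ ∑' k, y k := hsum.le_tsum n fun j _ => hynn j
    have h2 : g (y n) ≤ g (∑' k, y k) := by
      have := hg _ (sub_nonneg.2 h1)
      rw [map_sub] at this
      linarith
    refine le_trans ?_ h2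
    have h3 : c n * (4 ^ n * ‖x n‖) ≤ g (y n) := by
      simp only [hy, map_smul, smul_eq_mul]
      exact mul_le_mul_of_nonneg_left (hx n).le (hcpos n).le
    refine le_trans (le_of_eq ?_) h3
    have := (hxn n).ne'
    rw [show (4 : ℝ) = 2 * 2 by norm_num, mul_pow]
    simp only [hc]
    field_simp
  obtain ⟨n, hn⟩ := pow_unbounded_of_one_lt (g (∑' k, y k)) (one_lt_two (α := ℝ))
  exact absurd (hle n) (not_le.2 hn)

/-- A positive linear functional on `L^p` is continuous. -/
lemma exists_dual_of_nonneg [Fact (1 ≤ p)] (g : Lp ℝ p ℙ →ₗ[ℝ] ℝ) (hg : ∀ Z, 0 ≤ Z → 0 ≤ g Z) :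
    ∃ φ : StrongDual ℝ (Lp ℝ p ℙ), ∀ Z, φ Z = g Z := by
  obtain ⟨K, hK⟩ := exists_bound_of_nonneg g hg
  refine ⟨g.mkContinuous K fun Z => ?_, fun Z => rfl⟩
  have hmono {a b : Lp ℝ p ℙ} (h : a ≤ b) : g a ≤ g b := by
    have := hg _ (sub_nonneg.2 h)
    rw [map_sub] at this
    linarith
  have h1 := hK |Z| (abs_nonneg Z)
  rw [norm_abs_eq_norm] at h1
  refine le_trans (abs_le.2 ⟨?_, hmono (le_abs_self Z)⟩) h1
  have := hmono (neg_le_abs Z)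
  rw [map_neg] at this
  linarith

/-! ### Hahn–Banach for convex functions -/

section Sublinear

variable {E : Type*} [AddCommGroup E] [Module ℝ E] {f : E → ℝ}

/-- A finite convex function vanishing at the origin has a linear minorant. -/
lemma exists_linear_le_of_convex (hf : ConvexOn ℝ Set.univ f) (h0 : f 0 = 0) :
    ∃ g : E →ₗ[ℝ] ℝ, ∀ x, g x ≤ f x := by
  -- The one-sided directional derivative of `f` at the origin: sublinear and below `f`. Hahn–Banach
  -- then extends from the zero subspace.
  set N : E → ℝ := fun x => ⨅ t : Set.Ioi (0 : ℝ), f ((t : ℝ) • x) / t with hN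
  have hlb (x : E) (t : Set.Ioi (0 : ℝ)) : -f (-x) ≤ f ((t : ℝ) • x) / t := by
    obtain ⟨t, ht⟩ := t
    have ht : 0 < t := ht
    have h1 := hf.2 (Set.mem_univ (t • x)) (Set.mem_univ (-x))
      (show 0 ≤ 1 / (1 + t) by positivity) (show 0 ≤ t / (1 + t) by positivity) (by field_simp)
    have h2 : (1 / (1 + t)) • t • x + (t / (1 + t)) • (-x) = 0 := by
      rw [smul_smul, smul_neg, div_mul_eq_mul_div, one_mul, add_neg_cancel]
    rw [h2, h0, smul_eq_mul, smul_eq_mul, div_mul_eq_mul_div, div_mul_eq_mul_div, ← add_div] at h1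
    have h3 : 0 ≤ 1 * f (t • x) + t * f (-x) := by
      by_contra! h
      exact absurd h1 (not_le.2 (div_neg_of_neg_of_pos h (by positivity)))
    simp only
    rw [le_div_iff₀ ht]
    linarith
  have hbdd (x : E) : BddBelow (Set.range fun t : Set.Ioi (0 : ℝ) => f ((t : ℝ) • x) / t) :=
    ⟨-f (-x), by rintro _ ⟨t, rfl⟩; exact hlb x t⟩
  have : Nonempty (Set.Ioi (0 : ℝ)) := ⟨⟨1, Set.mem_Ioi.2 one_pos⟩⟩
  have hle (x : E) {t : ℝ} (ht : 0 < t) : N x ≤ f (t • x) / t := ciInf_le (hbdd x) ⟨t, ht⟩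
  have hadd (x y : E) : N (x + y) ≤ N x + N y := by
    refine le_ciInf_add_ciInf ?_
    rintro ⟨s, hs⟩ ⟨t, ht⟩
    have hs : 0 < s := hs
    have ht : 0 < t := ht
    refine (hle (x + y) (t := s * t / (s + t)) (by positivity)).trans ?_
    have h1 := hf.2 (Set.mem_univ (s • x)) (Set.mem_univ (t • y))
      (show 0 ≤ t / (s + t) by positivity) (show 0 ≤ s / (s + t) by positivity)
      (by field_simp; ring)
    have h2 : (t / (s + t)) • s • x + (s / (s + t)) • t • y = (s * t / (s + t)) • (x + y) := by
      rw [smul_smul, smul_smul, smul_add]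
      congr 2 <;> ring
    rw [h2, smul_eq_mul, smul_eq_mul] at h1
    rw [div_le_iff₀ (by positivity)]
    refine h1.trans (le_of_eq ?_)
    field_simp
  have hle_smul (c : ℝ) (hc : 0 < c) (x : E) : N (c • x) ≤ c * N x := by
    rw [← div_le_iff₀' hc]
    refine le_ciInf ?_
    rintro ⟨t, ht⟩
    have ht : 0 < t := ht
    rw [div_le_iff₀' hc]
    refine (hle (c • x) (t := t / c) (by positivity)).trans (le_of_eq ?_)
    rw [smul_smul, div_mul_cancel₀ _ hc.ne']
    field_simp
  have hsmul (c : ℝ) (hc : 0 < c) (x : E) : N (c • x) = c * N x := by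
    refine le_antisymm (hle_smul c hc x) ?_
    have := hle_smul c⁻¹ (inv_pos.2 hc) (c • x)
    rwa [smul_smul, inv_mul_cancel₀ hc.ne', one_smul, ← div_eq_inv_mul, le_div_iff₀' hc] at this
  obtain ⟨g, -, hg⟩ := exists_extension_of_le_sublinear (⊥ : E →ₗ.[ℝ] ℝ) N hsmul hadd (by
    rintro ⟨x, hx⟩
    have hx : x = 0 := (Submodule.mem_bot ℝ).1 hx
    subst hx
    have h : N 0 = 0 := by
      have := hsmul 2 two_pos 0
      rw [smul_zero] at this
      linarith
    rw [h]
    exact le_of_eq (map_zero _))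
  exact ⟨g, fun x => (hg x).trans (by simpa using hle x one_pos)⟩

end Sublinear

/-! ### Riesz representation by probability measures -/

/-- A probability measure with density in `L^q` induces a continuous functional on `L^p`. -/
lemma exists_dual_of_memLp_density [IsProbabilityMeasure ℙ] [Fact (1 ≤ p)] {P : Measure Ω}
    [IsProbabilityMeasure P] (hP : P ≪ ℙ) (hd : MemLp (density ℙ P) p.conjExponent ℙ) :
    ∃ φ : StrongDual ℝ (Lp ℝ p ℙ), ∀ Z : Lp ℝ p ℙ, φ Z = ∫ ω, Z ω ∂P := by
  have hc : p.HolderConjugate p.conjExponent := .conjExponent Fact.out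
  have : p.conjExponent.HolderConjugate p := hc.symm
  have : Fact (1 ≤ p.conjExponent) := ⟨by simp [ENNReal.conjExponent]⟩
  refine ⟨(ContinuousLinearMap.mul ℝ ℝ).lpPairing ℙ p.conjExponent p (hd.toLp _), fun Z => ?_⟩
  rw [ContinuousLinearMap.lpPairing_eq_integral, ← integral_toReal_rnDeriv_mul hP]
  refine integral_congr_ae ?_
  filter_upwards [hd.coeFn_toLp] with ω h
  rw [h]
  rfl

/-- The Riesz density of a continuous functional on `L^p`, `p ≤ 2`, tested against `L^2`. -/
lemma exists_memLp_two_density [IsProbabilityMeasure ℙ] [Fact (1 ≤ p)] (hp2 : p ≤ 2)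
    (φ : StrongDual ℝ (Lp ℝ p ℙ)) :
    ∃ f : Ω → ℝ, Measurable f ∧ MemLp f 2 ℙ ∧ ∀ (h : Ω → ℝ) (hh : MemLp h 2 ℙ),
      φ ((hh.mono_exponent hp2).toLp h) = ∫ ω, h ω * f ω ∂ℙ := by
  -- Since `p ≤ 2`, restricting along the inclusion of `L^2` in `L^p` reduces to Riesz in a Hilbert
  -- space.
  let ι₀ : Lp ℝ 2 ℙ →ₗ[ℝ] Lp ℝ p ℙ :=
    { toFun := fun Z => ((Lp.memLp Z).mono_exponent hp2).toLp Z
      map_add' := fun Y Z => by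
        rw [← MemLp.toLp_add]
        exact MemLp.toLp_congr _ _ (Lp.coeFn_add Y Z)
      map_smul' := fun c Z => by
        rw [RingHom.id_apply, ← MemLp.toLp_const_smul]
        exact MemLp.toLp_congr _ _ (Lp.coeFn_smul c Z) }
  let ι : Lp ℝ 2 ℙ →L[ℝ] Lp ℝ p ℙ := ι₀.mkContinuous 1 fun Z => by
    rw [one_mul]
    change ‖((Lp.memLp Z).mono_exponent hp2).toLp Z‖ ≤ ‖Z‖
    rw [Lp.norm_toLp, Lp.norm_def]
    exact ENNReal.toReal_mono (Lp.eLpNorm_ne_top Z)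
      (eLpNorm_le_eLpNorm_of_exponent_le hp2 (Lp.aestronglyMeasurable Z))
  let F : Lp ℝ 2 ℙ := (InnerProductSpace.toDual ℝ (Lp ℝ 2 ℙ)).symm (φ ∘L ι)
  have hF (Z : Lp ℝ 2 ℙ) : φ (ι Z) = ∫ ω, Z ω * F ω ∂ℙ := by
    have h1 : inner ℝ F Z = (φ ∘L ι) Z := InnerProductSpace.toDual_symm_apply
    rw [← ContinuousLinearMap.comp_apply, ← h1, L2.inner_def]
    rfl
  refine ⟨F, (Lp.stronglyMeasurable F).measurable, Lp.memLp F, fun h hh => ?_⟩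
  have h2 : ι (hh.toLp h) = (hh.mono_exponent hp2).toLp h :=
    MemLp.toLp_congr ((Lp.memLp _).mono_exponent hp2) _ hh.coeFn_toLp
  rw [← h2, hF]
  refine integral_congr_ae ?_
  filter_upwards [hh.coeFn_toLp] with ω h
  rw [h]

/-- If a nonnegative `f` represents a continuous functional on `L^p` on bounded functions, its
truncations are bounded in `L^q` by the norm of the functional. -/
lemma eLpNorm_truncation_le [IsProbabilityMeasure ℙ] [Fact (1 ≤ p)] (hp1 : 1 < p) (hp2 : p ≤ 2)
    (φ : StrongDual ℝ (Lp ℝ p ℙ)) {f : Ω → ℝ} (hfm : Measurable f) (hf : MemLp f 2 ℙ)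
    (hf0 : ∀ ω, 0 ≤ f ω)
    (hrep : ∀ (h : Ω → ℝ) (hh : MemLp h 2 ℙ),
      φ ((hh.mono_exponent hp2).toLp h) = ∫ ω, h ω * f ω ∂ℙ) (n : ℕ) :
    eLpNorm (fun ω => min (f ω) n) p.conjExponent ℙ ≤ ENNReal.ofReal ‖φ‖ := by
  have hptop : p ≠ ∞ := (hp2.trans_lt (by simp)).ne
  have hconj : p.HolderConjugate p.conjExponent := .conjExponent Fact.out
  have hpr : 1 < p.toReal := by
    simpa using (ENNReal.toReal_lt_toReal ENNReal.one_ne_top hptop).2 hp1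
  have hpq := ENNReal.HolderConjugate.toReal (q := p.conjExponent) hpr
  have hqtop : p.conjExponent ≠ ∞ := by
    simp [ENNReal.conjExponent, tsub_eq_zero_iff_le, hp1]
  set q := p.conjExponent with hq
  set r := q.toReal with hr
  have hr1 : 1 < r := hpq.symm.lt
  set h : Ω → ℝ := fun ω => min (f ω) n with hh
  have hh0 (ω : Ω) : 0 ≤ h ω := le_min (hf0 ω) n.cast_nonneg
  have hhm : Measurable h := hfm.min measurable_const
  have hhb (ω : Ω) : h ω ≤ n := min_le_right _ _
  have hhmem (s : ℝ≥0∞) : MemLp h s ℙ := MemLp.of_bound hhm.aestronglyMeasurable n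
    (.of_forall fun ω => by rw [Real.norm_of_nonneg (hh0 ω)]; exact hhb ω)
  -- The extremal test function in Hölder's inequality: `p (r - 1) = r` gives its `L^p` norm as `m ^
  -- (r - 1)`, while pairing it with `h` gives `m ^ r`.
  set g : Ω → ℝ := fun ω => h ω ^ (r - 1) with hg
  have hg0 (ω : Ω) : 0 ≤ g ω := Real.rpow_nonneg (hh0 ω) _
  have hgmem (s : ℝ≥0∞) : MemLp g s ℙ :=
    MemLp.of_bound (hhm.pow_const _).aestronglyMeasurable ((n : ℝ) ^ (r - 1))
      (.of_forall fun ω => by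
        rw [Real.norm_of_nonneg (hg0 ω)]
        exact Real.rpow_le_rpow (hh0 ω) (hhb ω) (by linarith))
  have hgh (ω : Ω) : g ω * h ω = h ω ^ r := by
    rcases (hh0 ω).eq_or_lt with h0 | h0
    · rw [← h0, mul_zero, Real.zero_rpow (by linarith)]
    · simp only [hg]
      rw [Real.rpow_sub_one h0.ne', div_mul_cancel₀ _ h0.ne']
  set m : ℝ := (eLpNorm h q ℙ).toReal with hm
  have hm0 : 0 ≤ m := ENNReal.toReal_nonneg
  have hnorm_g : (eLpNorm g p ℙ).toReal = m ^ (r - 1) := by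
    have h1 : g = fun ω => ‖h ω‖ ^ (r - 1) := by
      ext ω
      rw [Real.norm_of_nonneg (hh0 ω)]
    have h2 : p * ENNReal.ofReal (r - 1) = q := by
      rw [← ENNReal.toReal_eq_toReal_iff' (ENNReal.mul_ne_top hptop ENNReal.ofReal_ne_top) hqtop,
        ENNReal.toReal_mul, ENNReal.toReal_ofReal (by linarith)]
      have := hpq.mul_eq_add
      linarith
    rw [h1, eLpNorm_norm_rpow _ (by linarith), h2, ENNReal.toReal_rpow]
  have hint : ∫ ω, h ω ^ r ∂ℙ = m ^ r := by
    have h1 := (hhmem q).eLpNorm_eq_integral_rpow_norm hconj.symm.ne_zero hqtop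
    have h2 : 0 ≤ ∫ ω, h ω ^ r ∂ℙ := integral_nonneg fun ω => Real.rpow_nonneg (hh0 ω) _
    simp only [Real.norm_of_nonneg (hh0 _)] at h1
    rw [hm, h1, ENNReal.toReal_ofReal (by positivity), ← Real.rpow_mul h2,
      inv_mul_cancel₀ (by linarith), Real.rpow_one]
  have hle : m ^ r ≤ ‖φ‖ * m ^ (r - 1) := by
    calc m ^ r = ∫ ω, g ω * h ω ∂ℙ := by simp only [hgh, hint]
      _ ≤ ∫ ω, g ω * f ω ∂ℙ := by
        refine integral_mono ((hgmem 2).integrable_mul (hhmem 2)) ((hgmem 2).integrable_mul hf) ?_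
        intro ω
        exact mul_le_mul_of_nonneg_left (min_le_left _ _) (hg0 ω)
      _ = φ (((hgmem 2).mono_exponent hp2).toLp g) := (hrep g (hgmem 2)).symm
      _ ≤ ‖φ‖ * ‖((hgmem 2).mono_exponent hp2).toLp g‖ := (le_abs_self _).trans (φ.le_opNorm _)
      _ = ‖φ‖ * m ^ (r - 1) := by rw [Lp.norm_toLp, hnorm_g]
  rw [← ENNReal.ofReal_toReal (hhmem q).eLpNorm_ne_top]
  refine ENNReal.ofReal_le_ofReal ?_
  change m ≤ ‖φ‖
  rcases hm0.eq_or_lt with h0 | h0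
  · rw [← h0]; exact norm_nonneg _
  · have h1 : m ^ r = m * m ^ (r - 1) := by
      rw [Real.rpow_sub_one h0.ne', mul_div_cancel₀ _ h0.ne']
    rw [h1] at hle
    exact le_of_mul_le_mul_right hle (Real.rpow_pos_of_pos h0 _)

/-- A positive normalized functional on `L^p`, `1 < p ≤ 2`, is the expectation under a probability
measure with density in `L^q`. -/
lemma exists_measure_of_dual [IsProbabilityMeasure ℙ] [Fact (1 ≤ p)] (hp1 : 1 < p) (hp2 : p ≤ 2)
    (φ : StrongDual ℝ (Lp ℝ p ℙ)) (hpos : ∀ Z, 0 ≤ Z → 0 ≤ φ Z) (hone : φ (Lp.const p ℙ 1) = 1) :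
    ∃ P : Measure Ω, IsProbabilityMeasure P ∧ P ≪ ℙ ∧
      MemLp (density ℙ P) p.conjExponent ℙ ∧ ∀ Z : Lp ℝ p ℙ, φ Z = ∫ ω, Z ω ∂P := by
  have hptop : p ≠ ∞ := (hp2.trans_lt (by simp)).ne
  obtain ⟨f₀, hf₀m, hf₀, hrep₀⟩ := exists_memLp_two_density hp2 φ
  have hf₀int : Integrable f₀ ℙ := hf₀.integrable one_le_two
  have hf₀nn : 0 ≤ᵐ[ℙ] f₀ := by
    refine ae_nonneg_of_forall_setIntegral_nonneg hf₀int fun s hs _ => ?_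
    have hmem : MemLp (s.indicator fun _ => (1 : ℝ)) 2 ℙ :=
      memLp_indicator_const 2 hs 1 (Or.inr (measure_ne_top _ _))
    have h1 := hrep₀ _ hmem
    have h2 : ∫ ω, s.indicator (fun _ => (1 : ℝ)) ω * f₀ ω ∂ℙ = ∫ ω in s, f₀ ω ∂ℙ := by
      rw [← integral_indicator hs]
      refine integral_congr_ae (.of_forall fun ω => ?_)
      by_cases hω : ω ∈ s <;> simp [hω]
    rw [← h2, ← h1]
    refine hpos _ ?_
    rw [← Lp.coeFn_nonneg]
    filter_upwards [(hmem.mono_exponent hp2).coeFn_toLp] with ω hω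
    rw [hω]
    exact Set.indicator_nonneg (fun _ _ => zero_le_one) ω
  set f : Ω → ℝ := fun ω => max (f₀ ω) 0 with hfdef
  have hfm : Measurable f := hf₀m.max measurable_const
  have hf0 (ω : Ω) : 0 ≤ f ω := le_max_right _ _
  have hae : f₀ =ᵐ[ℙ] f := by
    filter_upwards [hf₀nn] with ω hω
    exact (max_eq_left hω).symm
  have hf : MemLp f 2 ℙ := hf₀.ae_eq hae
  have hrep (h : Ω → ℝ) (hh : MemLp h 2 ℙ) :
      φ ((hh.mono_exponent hp2).toLp h) = ∫ ω, h ω * f ω ∂ℙ := by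
    rw [hrep₀ h hh]
    refine integral_congr_ae ?_
    filter_upwards [hae] with ω hω
    rw [hω]
  have hfq : MemLp f p.conjExponent ℙ := by
    refine ⟨hfm.aestronglyMeasurable, lt_of_le_of_lt ?_ (ENNReal.ofReal_lt_top (r := ‖φ‖))⟩
    -- Fatou: the uniform bound on truncations passes to their limit `f`.
    refine (Lp.eLpNorm_lim_le_liminf_eLpNorm (f := fun (n : ℕ) ω => min (f ω) n)
      (fun n => (hfm.min measurable_const).aestronglyMeasurable) f (.of_forall fun ω => ?_)).trans ?_
    · obtain ⟨N, hN⟩ := exists_nat_ge (f ω)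
      refine tendsto_atTop_of_eventually_const (i₀ := N) fun n hn => min_eq_left ?_
      exact hN.trans (Nat.cast_le.2 hn)
    · exact Filter.liminf_le_of_le (by isBoundedDefault) fun b hb =>
        let ⟨n, hn⟩ := hb.exists
        hn.trans (eLpNorm_truncation_le hp1 hp2 φ hfm hf hf0 hrep n)
  have hint : ∫ ω, f ω ∂ℙ = 1 := by
    have h1 := hrep (fun _ => 1) (memLp_const 1)
    simp only [one_mul] at h1
    exact h1.symm.trans hone
  set P : Measure Ω := ℙ.withDensity fun ω => ENNReal.ofReal (f ω) with hPdef
  have hPac : P ≪ ℙ := withDensity_absolutelyContinuous _ _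
  have hPprob : IsProbabilityMeasure P := by
    constructor
    rw [hPdef, withDensity_apply _ MeasurableSet.univ, setLIntegral_univ,
      ← ofReal_integral_eq_lintegral_ofReal (hf.integrable one_le_two) (.of_forall hf0), hint,
      ENNReal.ofReal_one]
  have hdens : density ℙ P =ᵐ[ℙ] f := by
    filter_upwards [Measure.rnDeriv_withDensity₀ ℙ (hfm.ennreal_ofReal.aemeasurable)] with ω hω
    rw [density, hω, ENNReal.toReal_ofReal (hf0 ω)]
  have hdq : MemLp (density ℙ P) p.conjExponent ℙ := hfq.ae_eq hdens.symm
  obtain ⟨ψ, hψ⟩ := exists_dual_of_memLp_density hPac hdq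
  refine ⟨P, hPprob, hPac, hdq, fun Z => ?_⟩
  rw [← hψ]
  have key (h : Ω → ℝ) (hh : MemLp h 2 ℙ) : φ ((hh.mono_exponent hp2).toLp h) =
      ψ ((hh.mono_exponent hp2).toLp h) := by
    rw [hrep h hh, hψ, ← integral_toReal_rnDeriv_mul hPac]
    refine integral_congr_ae ?_
    filter_upwards [hdens, (hh.mono_exponent hp2).coeFn_toLp] with ω h1 h2
    rw [h2, ← h1, mul_comm]
    rfl
  refine Lp.induction hptop (fun Z => φ Z = ψ Z) (fun c s hs hμs => ?_) ?_ ?_ Z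
  · exact key _ (memLp_indicator_const 2 hs c (Or.inr hμs.ne))
  · intro _ _ _ _ _ h1 h2
    rw [map_add, map_add, h1, h2]
  · exact isClosed_eq φ.continuous ψ.continuous

/-! ### Extended-real penalties and existence of a prior -/

/-- Nonemptiness of `A` keeps the supremum away from `⊥`; it may still be `⊤`, so the subtraction
has to be rearranged in `EReal`. -/
lemma le_coe_sub_iSup_iff {ι : Type*} {A : Set ι} (hA : A.Nonempty) (a : ι → ℝ) (x : ℝ)
    (b : EReal) :
    b ≤ (x : EReal) - ⨆ i ∈ A, (a i : EReal) ↔ ∀ i ∈ A, b ≤ ((x - a i : ℝ) : EReal) := by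
  obtain ⟨i₀, hi₀⟩ := hA
  have hbot : (⨆ i ∈ A, (a i : EReal)) ≠ ⊥ := fun h =>
    EReal.coe_ne_bot (a i₀) (le_bot_iff.1 (h ▸ le_iSup₂_of_le i₀ hi₀ le_rfl))
  induction b with
  | bot => simp
  | top =>
    refine iff_of_false (fun h => ?_) fun h => absurd (top_le_iff.1 (h i₀ hi₀)) (EReal.coe_ne_top _)
    have h1 : (x : EReal) - ⨆ i ∈ A, (a i : EReal) ≤ ((x - a i₀ : ℝ) : EReal) := by
      rw [EReal.coe_sub]
      exact EReal.sub_le_sub le_rfl (le_iSup₂_of_le i₀ hi₀ le_rfl)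
    exact EReal.coe_ne_top _ (top_le_iff.1 (h.trans h1))
  | coe b =>
    rw [EReal.le_sub_iff_add_le (Or.inl hbot) (Or.inr (EReal.coe_ne_top x)), add_comm,
      ← EReal.le_sub_iff_add_le (Or.inr (EReal.coe_ne_bot x)) (Or.inr (EReal.coe_ne_top x)),
      iSup₂_le_iff]
    refine forall₂_congr fun i _ => ?_
    rw [← EReal.coe_sub, EReal.coe_le_coe_iff, EReal.coe_le_coe_iff, le_sub_comm]

lemma coe_sub_iSup {ι : Type*} {A : Set ι} (hA : A.Nonempty) (a : ι → ℝ) (x : ℝ) :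
    (x : EReal) - ⨆ i ∈ A, (a i : EReal) = ⨅ i ∈ A, ((x - a i : ℝ) : EReal) :=
  eq_of_forall_le_iff fun b => by rw [le_coe_sub_iSup_iff hA, le_iInf₂_iff]

lemma IsConvexOperator.convexOn [IsProbabilityMeasure ℙ] {ρ : Lp ℝ p ℙ → ℝ}
    (hρ : IsConvexOperator ℙ p ρ) : ConvexOn ℝ Set.univ ρ := by
  refine ⟨convex_univ, fun x _ y _ a b ha hb hab => ?_⟩
  obtain rfl : b = 1 - a := by linarith
  exact hρ.convex x y a ha (by linarith)

lemma IsConvexOperator.apply_const [IsProbabilityMeasure ℙ] {ρ : Lp ℝ p ℙ → ℝ}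
    (hρ : IsConvexOperator ℙ p ρ) (hnorm : IsNormalized ρ) (c : ℝ) : ρ (Lp.const p ℙ c) = c := by
  have := hρ.const_invariance 0 c
  rwa [zero_add, hnorm, zero_add] at this

lemma Lp_const_eq_smul [IsFiniteMeasure ℙ] (c : ℝ) :
    Lp.const p ℙ c = c • Lp.const p ℙ (1 : ℝ) := by
  rw [← Lp.constₗ_apply p ℙ ℝ, ← Lp.constₗ_apply p ℙ ℝ, ← map_smul, smul_eq_mul, mul_one]

/-- The representation set of a normalized convex operator is nonempty. -/
lemma representationSet_nonempty [IsProbabilityMeasure ℙ] (hp1 : 1 < p) (hp2 : p ≤ 2)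
    {ρ : Lp ℝ p ℙ → ℝ} (hρ : IsConvexOperator ℙ p ρ) (hnorm : IsNormalized ρ) :
    (representationSet ρ).Nonempty := by
  have : Fact (1 ≤ p) := ⟨hp1.le⟩
  obtain ⟨g, hg⟩ := exists_linear_le_of_convex hρ.convexOn hnorm
  have hpos (Z : Lp ℝ p ℙ) (hZ : 0 ≤ Z) : 0 ≤ g Z := by
    have h1 := (hg (-Z)).trans (hρ.monotone 0 (-Z) (neg_nonpos.2 hZ))
    rw [hnorm, map_neg] at h1
    linarith
  have hone : g (Lp.const p ℙ 1) = 1 := by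
    have h1 := hg (Lp.const p ℙ 1)
    have h2 := hg (Lp.const p ℙ (-1))
    rw [hρ.apply_const hnorm] at h1 h2
    rw [map_neg, map_neg] at h2
    linarith
  obtain ⟨φ, hφ⟩ := exists_dual_of_nonneg g hpos
  obtain ⟨P, hP, hac, hd, hrep⟩ := exists_measure_of_dual hp1 hp2 φ
    (fun Z hZ => by rw [hφ]; exact hpos Z hZ) (by rw [hφ, hone])
  -- The minorant satisfies `g ζ ≤ ρ ζ ≤ 0` on the acceptance set, so this prior has penalty at most
  -- `0`.
  refine ⟨P, hP, hac, hd, lt_of_le_of_lt (iSup₂_le fun ζ hζ => ?_) (EReal.coe_lt_top 0)⟩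
  rw [EReal.coe_le_coe_iff, ← hrep, hφ]
  exact (hg ζ).trans hζ

/-! ### Weak-* compactness and attainment -/

section Attainment

variable (ρ : Lp ℝ p ℙ → ℝ) (D : Set (Lp ℝ p ℙ))

/-- The dual form of the value of a prior: the loss of each estimator is an element of `D`. -/
noncomputable def dualValue [Fact (1 ≤ p)] (φ : WeakDual ℝ (Lp ℝ p ℙ)) : EReal :=
  ⨅ Y ∈ D, ⨅ ζ ∈ acceptanceSet ρ, ((φ Y - φ ζ : ℝ) : EReal)

lemma upperSemicontinuous_dualValue [Fact (1 ≤ p)] : UpperSemicontinuous (dualValue ρ D) := by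
  refine upperSemicontinuous_biInf fun Y _ => upperSemicontinuous_biInf fun ζ _ => ?_
  exact (continuous_coe_real_ereal.comp
    ((WeakDual.eval_continuous Y).sub (WeakDual.eval_continuous ζ))).upperSemicontinuous

variable {ρ D}

/-- `X + Z - ρ(X + Z)` is acceptable, and `φ X` cancels when it is tested against the loss `X`. This
is the coercivity behind compactness. -/
lemma IsConvexOperator.apply_le_of_le_dualValue [IsProbabilityMeasure ℙ] [Fact (1 ≤ p)]
    (hρ : IsConvexOperator ℙ p ρ) {φ : WeakDual ℝ (Lp ℝ p ℙ)} (hone : φ (Lp.const p ℙ 1) = 1)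
    {c : ℝ} (hc : (c : EReal) ≤ dualValue ρ D φ) {X : Lp ℝ p ℙ} (hX : X ∈ D) (Z : Lp ℝ p ℙ) :
    φ Z ≤ ρ (X + Z) - c := by
  have hacc : X + Z + Lp.const p ℙ (-ρ (X + Z)) ∈ acceptanceSet ρ := by
    change ρ _ ≤ 0
    rw [hρ.const_invariance, add_neg_cancel]
  have h1 := le_iInf₂_iff.1 (le_iInf₂_iff.1 hc X hX) _ hacc
  rw [EReal.coe_le_coe_iff, map_add, map_add, Lp_const_eq_smul, map_smul, hone, smul_eq_mul,
    mul_one] at h1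
  linarith

/-- The dual value attains its maximum over the positive normalized functionals. -/
lemma exists_isMax_dualValue [IsProbabilityMeasure ℙ] [Fact (1 ≤ p)]
    (hρ : IsConvexOperator ℙ p ρ) (hD : D.Nonempty) {φ₀ : WeakDual ℝ (Lp ℝ p ℙ)}
    (hpos : ∀ Z, 0 ≤ Z → 0 ≤ φ₀ Z) (hone : φ₀ (Lp.const p ℙ 1) = 1)
    {c : ℝ} (hc : (c : EReal) ≤ dualValue ρ D φ₀) :
    ∃ φ : WeakDual ℝ (Lp ℝ p ℙ), (∀ Z, 0 ≤ Z → 0 ≤ φ Z) ∧ φ (Lp.const p ℙ 1) = 1 ∧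
      ∀ ψ : WeakDual ℝ (Lp ℝ p ℙ), (∀ Z, 0 ≤ Z → 0 ≤ ψ Z) → ψ (Lp.const p ℙ 1) = 1 →
        dualValue ρ D ψ ≤ dualValue ρ D φ := by
  obtain ⟨X, hX⟩ := hD
  -- `K` contains every competitor with value at least `c`; those outside it are already beaten by
  -- `φ₀`.
  set K : Set (WeakDual ℝ (Lp ℝ p ℙ)) := {φ | (∀ Z, 0 ≤ Z → 0 ≤ φ Z) ∧
    φ (Lp.const p ℙ 1) = 1 ∧ ∀ Z, φ Z ≤ ρ (X + Z) - c} with hK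
  have hclosed : IsClosed K := by
    refine IsClosed.and ?_ (IsClosed.and ?_ ?_)
    · simp only [Set.ofPred_forall]
      exact isClosed_iInter fun Z => isClosed_iInter fun _ =>
        isClosed_le continuous_const (WeakDual.eval_continuous Z)
    · exact isClosed_eq (WeakDual.eval_continuous _) continuous_const
    · simp only [Set.ofPred_forall]
      exact isClosed_iInter fun Z => isClosed_le (WeakDual.eval_continuous Z) continuous_const
  have hbdd : ∃ B : ℝ, ∀ φ : K, ‖WeakDual.toStrongDual φ.1‖ ≤ B := by
    refine banach_steinhaus fun Z =>
      ⟨max (ρ (X + Z) - c) (ρ (X + -Z) - c), fun φ => abs_le'.2 ⟨?_, ?_⟩⟩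
    · exact (φ.2.2.2 Z).trans (le_max_left _ _)
    · refine le_trans (le_of_eq ?_) ((φ.2.2.2 (-Z)).trans (le_max_right _ _))
      exact (map_neg φ.1 Z).symm
  obtain ⟨B, hB⟩ := hbdd
  have hcomp : IsCompact K := by
    refine (WeakDual.isCompact_closedBall (𝕜 := ℝ) (0 : StrongDual ℝ (Lp ℝ p ℙ)) B).of_isClosed_subset
      hclosed fun φ hφ => ?_
    simpa using hB ⟨φ, hφ⟩
  have hφ₀ : φ₀ ∈ K := ⟨hpos, hone, hρ.apply_le_of_le_dualValue hone hc hX⟩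
  obtain ⟨φ, hφ, hmax⟩ := UpperSemicontinuousOn.exists_isMaxOn ⟨φ₀, hφ₀⟩ hcomp
    ((upperSemicontinuous_dualValue ρ D).upperSemicontinuousOn K)
  refine ⟨φ, hφ.1, hφ.2.1, fun ψ hψ hψ1 => ?_⟩
  rcases le_total (c : EReal) (dualValue ρ D ψ) with h | h
  · exact hmax (show ψ ∈ K from ⟨hψ, hψ1, hρ.apply_le_of_le_dualValue hψ1 h hX⟩)
  · exact h.trans (hc.trans (hmax hφ₀))

end Attainment

/-! ### Back to priors and estimators -/

lemma memLp_sq {f : Ω → ℝ} (hf : MemLp f (2 * p) ℙ) : MemLp (fun ω => f ω ^ 2) p ℙ := by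
  have h := hf.norm_rpow_div (q := 2)
  have h2 : 2 * p / 2 = p := by
    rw [mul_comm]
    exact ENNReal.mul_div_cancel_right (by simp) (by simp)
  rw [h2] at h
  refine h.ae_eq (.of_forall fun ω => ?_)
  simp

/-- The value of a member of the representation set in dual form. -/
lemma infValue_eq_dualValue [IsProbabilityMeasure ℙ] [Fact (1 ≤ p)] {ρ : Lp ℝ p ℙ → ℝ}
    (hnorm : IsNormalized ρ) {ξ : Ω → ℝ} {S : Set (Ω → ℝ)}
    (hS : ∀ η ∈ S, MemLp (fun ω => (ξ ω - η ω) ^ 2) p ℙ) {P : Measure Ω} (hac : P ≪ ℙ)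
    {φ : WeakDual ℝ (Lp ℝ p ℙ)} (hφ : ∀ Z : Lp ℝ p ℙ, φ Z = ∫ ω, Z ω ∂P) :
    infValue ρ ξ S P =
      dualValue ρ {Y | ∃ η ∈ S, ⇑Y =ᵐ[ℙ] fun ω => (ξ ω - η ω) ^ 2} φ := by
  have hA : (acceptanceSet ρ).Nonempty := ⟨0, hnorm.le⟩
  have hobj {η : Ω → ℝ} {Y : Lp ℝ p ℙ} (hY : ⇑Y =ᵐ[ℙ] fun ω => (ξ ω - η ω) ^ 2) :
      objective ρ ξ P η = ⨅ ζ ∈ acceptanceSet ρ, ((φ Y - φ ζ : ℝ) : EReal) := by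
    rw [objective, penalty, coe_sub_iSup hA]
    simp only [hφ, integral_congr_ae (hac.ae_eq hY)]
  refine le_antisymm (le_iInf₂ ?_) (le_iInf₂ fun η hη => ?_)
  · rintro Y ⟨η, hη, hY⟩
    exact (iInf₂_le η hη).trans (hobj hY).le
  · have hY := (hS η hη).coeFn_toLp
    rw [hobj hY]
    exact iInf₂_le _ ⟨η, hη, hY⟩

/-- The maximal value over the representation set is attained, for every nonempty set of estimators
with `p`-integrable quadratic loss. -/
theorem exists_infValue_eq_supInfValue [IsProbabilityMeasure ℙ] (hp1 : 1 < p) (hp2 : p ≤ 2)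
    {ρ : Lp ℝ p ℙ → ℝ} (hρ : IsConvexOperator ℙ p ρ) (hnorm : IsNormalized ρ)
    {ξ : Ω → ℝ} {S : Set (Ω → ℝ)} (hne : S.Nonempty)
    (hS : ∀ η ∈ S, MemLp (fun ω => (ξ ω - η ω) ^ 2) p ℙ) :
    ∃ P ∈ representationSet ρ, infValue ρ ξ S P = supInfValue ρ ξ S := by
  have : Fact (1 ≤ p) := ⟨hp1.le⟩
  set D : Set (Lp ℝ p ℙ) := {Y | ∃ η ∈ S, ⇑Y =ᵐ[ℙ] fun ω => (ξ ω - η ω) ^ 2} with hD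
  have hDne : D.Nonempty := by
    obtain ⟨η, hη⟩ := hne
    exact ⟨(hS η hη).toLp _, η, hη, (hS η hη).coeFn_toLp⟩
  have hdual (P : Measure Ω) (hP : P ∈ representationSet ρ) : ∃ φ : WeakDual ℝ (Lp ℝ p ℙ),
      (∀ Z, 0 ≤ Z → 0 ≤ φ Z) ∧ φ (Lp.const p ℙ 1) = 1 ∧ infValue ρ ξ S P = dualValue ρ D φ := by
    obtain ⟨hprob, hac, hd, -⟩ := hP
    obtain ⟨φ, hφ⟩ := exists_dual_of_memLp_density hac hd
    refine ⟨StrongDual.toWeakDual φ, fun Z hZ => ?_, ?_, infValue_eq_dualValue hnorm hS hac hφ⟩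
    · exact (integral_nonneg_of_ae (hac.ae_le ((Lp.coeFn_nonneg Z).2 hZ))).trans_eq (hφ Z).symm
    · refine (hφ _).trans ?_
      rw [integral_congr_ae (hac.ae_eq (Lp.coeFn_const p ℙ (1 : ℝ)))]
      simp
  obtain ⟨P₀, hP₀⟩ := representationSet_nonempty hp1 hp2 hρ hnorm
  obtain ⟨φ₀, hpos₀, hone₀, hval₀⟩ := hdual P₀ hP₀
  have hpen₀ : penalty ρ P₀ ≤ ((penalty ρ P₀).toReal : EReal) :=
    EReal.le_coe_toReal hP₀.2.2.2.ne
  -- The loss is nonnegative, so minus the penalty of `P₀` is a real lower bound for its value.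
  have hc : ((-(penalty ρ P₀).toReal : ℝ) : EReal) ≤ dualValue ρ D φ₀ := by
    rw [← hval₀]
    refine le_iInf₂ fun η _ => ?_
    have h1 : (0 : ℝ) ≤ ∫ ω, (ξ ω - η ω) ^ 2 ∂P₀ := integral_nonneg fun ω => sq_nonneg _
    refine le_trans ?_ (EReal.sub_le_sub (EReal.coe_le_coe_iff.2 h1) hpen₀)
    rw [← EReal.coe_sub, zero_sub]
  obtain ⟨φ, hpos, hone, hmax⟩ := exists_isMax_dualValue hρ hDne hpos₀ hone₀ hc
  obtain ⟨P, hprob, hac, hd, hrep⟩ :=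
    exists_measure_of_dual hp1 hp2 (WeakDual.toStrongDual φ) hpos hone
  have hval : infValue ρ ξ S P = dualValue ρ D φ := infValue_eq_dualValue hnorm hS hac hrep
  have hP : P ∈ representationSet ρ := by
    refine ⟨hprob, hac, hd, lt_of_not_ge fun htop => ?_⟩
    obtain ⟨η, hη⟩ := hne
    have h1 : infValue ρ ξ S P ≤ ⊥ := by
      refine (iInf₂_le η hη).trans ?_
      rw [objective, top_le_iff.1 htop, EReal.sub_top]
    rw [hval] at h1
    exact EReal.coe_ne_bot _ (le_bot_iff.1 ((hc.trans (hmax φ₀ hpos₀ hone₀)).trans h1))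
  refine ⟨P, hP, le_antisymm (le_iSup₂_of_le P hP le_rfl) (iSup₂_le fun Q hQ => ?_)⟩
  obtain ⟨ψ, hψ, hψ1, hψval⟩ := hdual Q hQ
  rw [hψval, hval]
  exact hmax ψ hψ hψ1

lemma zero_mem_LCBall {C : MeasurableSpace Ω} {r : ℝ≥0∞} {M : ℝ} :
    (0 : Ω → ℝ) ∈ LCBall ℙ C r M :=
  ⟨⟨measurable_const, MemLp.zero⟩, by simp⟩

lemma memLp_sq_sub_of_mem_LC [IsProbabilityMeasure ℙ] {C : MeasurableSpace Ω} {ξ η : Ω → ℝ}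
    (hξ : MemLp ξ (4 * p) ℙ) (hη : η ∈ LC ℙ C (2 * p)) :
    MemLp (fun ω => (ξ ω - η ω) ^ 2) p ℙ :=
  memLp_sq ((hξ.mono_exponent (by gcongr; norm_num)).sub hη.2)

end MMSE

theorem mainTheorem6 {Ω : Type*} {mΩ : MeasurableSpace Ω} (ℙ : Measure Ω) [IsProbabilityMeasure ℙ]
    (p : ℝ≥0∞) (hp1 : 1 < p) (hp2 : p ≤ 2)
    (ρ : Lp ℝ p ℙ → ℝ) (hρ : MMSE.IsConvexOperator ℙ p ρ) (hnorm : MMSE.IsNormalized ρ)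
    (hstable : MMSE.IsStable ρ) (hproper : MMSE.IsProper ρ)
    (C : MeasurableSpace Ω) (hC : C ≤ mΩ)
    (ξ : Ω → ℝ) (hξ : MemLp ξ (4 * p) ℙ) :
    (∀ M : ℝ, 0 ≤ M → ∃ Phat ∈ MMSE.representationSet ρ,
      (MMSE.infValue ρ ξ (MMSE.LCBall ℙ C (2 * p) M) Phat : EReal) =
        MMSE.supInfValue ρ ξ (MMSE.LCBall ℙ C (2 * p) M)) ∧
    (∃ Phat ∈ MMSE.representationSet ρ,
      (MMSE.infValue ρ ξ (MMSE.LC ℙ C (2 * p)) Phat : EReal) =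
        MMSE.supInfValue ρ ξ (MMSE.LC ℙ C (2 * p))) ∧
    (∀ M : ℝ, 0 ≤ M →
      (∀ P ∈ MMSE.representationSet ρ,
        (MMSE.infValue ρ ξ (MMSE.LC ℙ C (2 * p)) P : EReal) =
          MMSE.infValue ρ ξ (MMSE.LCBall ℙ C (2 * p) M) P) →
      ∃ Phat ∈ MMSE.representationSet ρ,
        (MMSE.infValue ρ ξ (MMSE.LCBall ℙ C (2 * p) M) Phat : EReal) =
          MMSE.supInfValue ρ ξ (MMSE.LCBall ℙ C (2 * p) M) ∧
        (MMSE.infValue ρ ξ (MMSE.LC ℙ C (2 * p)) Phat : EReal) =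
          MMSE.supInfValue ρ ξ (MMSE.LC ℙ C (2 * p))) := by
  refine ⟨fun M _ => MMSE.exists_infValue_eq_supInfValue hp1 hp2 hρ hnorm
      ⟨0, MMSE.zero_mem_LCBall⟩ fun η hη => MMSE.memLp_sq_sub_of_mem_LC hξ hη.1,
    MMSE.exists_infValue_eq_supInfValue hp1 hp2 hρ hnorm
      ⟨0, (MMSE.zero_mem_LCBall (M := 0)).1⟩ fun η hη => MMSE.memLp_sq_sub_of_mem_LC hξ hη,
    fun M _ h => ?_⟩
  -- The two value functions agree on the whole representation set, so a maximizer of one maximizes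
  -- the other.
  obtain ⟨P, hP, hmax⟩ := MMSE.exists_infValue_eq_supInfValue hp1 hp2 hρ hnorm (ξ := ξ)
    (S := MMSE.LC ℙ C (2 * p)) ⟨0, (MMSE.zero_mem_LCBall (M := 0)).1⟩
    fun η hη => MMSE.memLp_sq_sub_of_mem_LC hξ hη
  refine ⟨P, hP, ?_, hmax⟩
  rw [← h P hP, hmax]
  exact biSup_congr h
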